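/- Let $d\ge 2$, let $\mathbb S=\mathbb R/\mathbb Z$ be the unit circle (angles measured in turns), and let $\sigma_d(\theta)=d\theta \bmod 1$. The image of the chord $\overline{ab}$ of the closed unit disk is $\sigma_d(\overline{ab})=\overline{\sigma_d(a)\sigma_d(b)}$; a chord may be degenerate, that is, a point of $\mathbb S$. A \emph{lamination} is a closed set of chords that pairwise do not cross inside the open disk and that contains all points of $\mathbb S$; its non-degenerate chords are its \emph{leaves}. A lamination $\mathcal L$ is \emph{$\sigma_d$-invariant} if (1) for each $\ell\in\mathcal L$, $\sigma_d(\ell)$ is in $\mathcal L$ or is a point; (2) each $\ell\in\mathcal L$ is $\sigma_d(\ell')$ for some $\ell'\in\mathcal L$; (3) for each $\ell\in\mathcal L$ such that $\sigma_d(\ell)$ is not a point there are $d$ pairwise disjoint leaves $\ell_1=\ell,\ell_2,\dots,\ell_d$ in $\mathcal L$ with $\sigma_d(\ell_i)=\sigma_d(\ell)$ for all $i$. A \emph{polygon} is the convex hull of a finite set of at least two points of $\mathbb S$, its vertices (a polygon with two vertices is a chord, which is then its only side). The polygon $P$ \emph{lies in} the lamination $\mathcal L$ if all sides of $P$ are leaves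 of $\mathcal L$ and no diagonal of $P$ is a leaf of $\mathcal L$ (so $P$ is a finite gap of $\mathcal L$, or a leaf). A set $\mathcal P$ of polygons is \emph{forward invariant} if for every $P\in\mathcal P$ no side of $P$ is mapped to a point by $\sigma_d$, and the polygon $\sigma_d(P)$ whose vertices are the images of the vertices of $P$ is in $\mathcal P$. The polygon $P$ \emph{maps forward as a positively oriented covering map} if any two vertices of $P$ that are consecutive in counterclockwise order are mapped to two distinct vertices of $\sigma_d(P)$ that are consecutive in counterclockwise order (if $\sigma_d(P)$ is a chord $\overline{xy}$, this means that the vertices of $P$ alternate between preimages of $x$ and of $y$). \textbf{Theorem.} Let $\mathcal P$ be a finite, forward invariant set of pairwise disjoint polygons. There is a $\sigma_d$-invariant lamination in which all polygons of $\mathcal P$ lie if and only if every polygon of $\mathcal P$ maps forward as a positively oriented covering map. -/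

import Mathlib

namespace Lam

open Set

/-- The circle `ℝ / ℤ`; angles are measured in turns.  Mathlib's circular order on it is the
counterclockwise one: `sbtw a b c` says that `a`, `b`, `c` are distinct and are met in this order
when the circle is traversed counterclockwise. -/
abbrev S : Type := UnitAddCircle

/-- The map `σ_d(θ) = d θ mod 1`. -/
def sigma (d : ℕ) (x : S) : S := d • x

/-- The image `σ_d(ab) = σ_d(a) σ_d(b)` of a chord.  The unordered pair `s(a, b)` stands for the
chord with endpoints `a` and `b`; the chord is a single point of the circle iff `a = b`
(`Sym2.IsDiag`). -/
def sigmaChord (d : ℕ) (l : Sym2 S) : Sym2 S := l.map (sigma d)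

/-- The chords `ab` and `ce` cross in the open disk: `c` and `e` lie in different components of the
complement of `{a, b}` in the circle. -/
def Crosses (a b c e : S) : Prop :=
  (sbtw a c b ∧ sbtw b e a) ∨ (sbtw a e b ∧ sbtw b c a)

/-- A lamination: a closed set of pairwise non-crossing chords that contains all points of the
circle.  A chord of the lamination is a leaf if it is not a point. -/
structure Lamination where
  chords : Set (Sym2 S)
  closed : IsClosed {p : S × S | s(p.1, p.2) ∈ chords}
  point_mem : ∀ x : S, s(x, x) ∈ chords
  not_crosses : ∀ a b c e : S, s(a, b) ∈ chords → s(c, e) ∈ chords → ¬ Crosses a b c e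

/-- Sibling `d`-invariant laminations.  Chords of one lamination do not cross, so two of them are
disjoint iff they have no common endpoint. -/
structure Lamination.IsInvariant (d : ℕ) (L : Lamination) : Prop where
  image_mem : ∀ l ∈ L.chords, sigmaChord d l ∈ L.chords ∨ (sigmaChord d l).IsDiag
  exists_preimage : ∀ l ∈ L.chords, ∃ l' ∈ L.chords, sigmaChord d l' = l
  exists_siblings : ∀ l ∈ L.chords, ¬ (sigmaChord d l).IsDiag →
    ∃ m : Fin d → Sym2 S, (∃ i, m i = l) ∧
      (∀ i, m i ∈ L.chords ∧ sigmaChord d (m i) = sigmaChord d l) ∧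
      ∀ i j, i ≠ j → ∀ x : S, ¬ (x ∈ m i ∧ x ∈ m j)

/-- A polygon inscribed in the circle, given by its finite set of at least two vertices
(a polygon with two vertices is a single chord). -/
structure Polygon where
  vertices : Set S
  finite : vertices.Finite
  nontrivial : vertices.Nontrivial

/-- `b` is the next point of `V` after `a` in counterclockwise order; thus `ab` is a side of the
convex hull of `V`, directed counterclockwise.  If `V = {a, b}` with `a ≠ b`, then both `(a, b)` and
`(b, a)` are directed sides. -/
def IsSide (V : Set S) (a b : S) : Prop :=
  a ∈ V ∧ b ∈ V ∧ a ≠ b ∧ ∀ c ∈ V, ¬ sbtw a c b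

/-- The convex hulls of the two vertex sets are disjoint: there is no common vertex, and no chord
between vertices of `P` crosses a chord between vertices of `Q`. -/
def Polygon.IsDisjoint (P Q : Polygon) : Prop :=
  Disjoint P.vertices Q.vertices ∧
    ∀ a ∈ P.vertices, ∀ b ∈ P.vertices, ∀ c ∈ Q.vertices, ∀ e ∈ Q.vertices, ¬ Crosses a b c e

/-- A set of polygons is forward invariant: no side of a polygon of the set is collapsed to a point,
and the image of each polygon of the set is a polygon of the set. -/
def ForwardInvariant (d : ℕ) (F : Set Polygon) : Prop :=
  ∀ P ∈ F, (∀ a b, IsSide P.vertices a b → sigma d a ≠ sigma d b) ∧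
    ∃ Q ∈ F, Q.vertices = sigma d '' P.vertices

/-- `P` maps forward as a positively oriented covering map: the boundary of `P` is mapped to the
boundary of the image polygon so that each directed side goes to a directed side, i.e. vertices that
are consecutive in counterclockwise order go to vertices that are consecutive in counterclockwise
order.  If the image has only two vertices, this says that the vertices of `P` alternate between
their preimages. -/
def Polygon.MapsAsPositiveCovering (d : ℕ) (P : Polygon) : Prop :=
  ∀ a b, IsSide P.vertices a b → IsSide (sigma d '' P.vertices) (sigma d a) (sigma d b)

/-- `P` is a polygon of the lamination `L` (a finite gap, or a single leaf if `P` has two vertices):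
its sides are leaves of `L`, and no diagonal of `P` is a leaf of `L`.  A leaf that runs through the
interior of `P` and does not cross the sides of `P` is a diagonal, so that no leaf of `L` meets the
interior of `P`. -/
def Lamination.HasPolygon (L : Lamination) (P : Polygon) : Prop :=
  ∀ a ∈ P.vertices, ∀ b ∈ P.vertices, a ≠ b →
    (s(a, b) ∈ L.chords ↔ IsSide P.vertices a b ∨ IsSide P.vertices b a)

end Lam

namespace Lam

open Set

/-! Necessity is a counting argument. Siblings of a leaf match the fibre over one endpoint of its
image bijectively with the fibre over the other, by leaves. If such a matching joins `u` to a point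
outside the arc from `u` to `v`, where `uv` is a leaf, then counting fibre points in that arc gives
a matching leaf that leaves it, and non-crossing forces this leaf to start at `v`
(`matching_leaves_arc`). Hence two adjacent leaves whose images are in positive order are in
positive order themselves. If a side of a polygon were mapped backwards, the next sides would have
to fold back and forth over the same image side. So the image would have two vertices only, and
there both directions are sides.

Sufficiency pulls the polygons back. A point `u` over a vertex of `Q` that is on no polygon yet lies
in one component of the complement of the present polygons, and all points over vertices of `Q`
visible there form a new polygon. It covers `Q` positively: a walk along the boundary of the
component cannot skip the next vertex of `Q`, because each polygon met on the way maps to `Q` or to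
a polygon disjoint from `Q` (`sigma_mem_Ioc_of_walk`, `Covers.exists_polygon`). Iteration gives a
completely invariant family, usually infinite. The closure of its sides is the lamination:
non-crossing passes to limits because crossing is an open condition, and images, preimages and
siblings pass to limits by continuity and compactness. -/

/-! ### Counterclockwise distance on the circle -/

/-- The counterclockwise distance from `a` to `b`, as a number in `[0, 1)`. -/
noncomputable def ccw (a b : S) : ℝ := (AddCircle.equivIco 1 0 (b - a) : ℝ)

lemma ccw_nonneg (a b : S) : 0 ≤ ccw a b := (AddCircle.equivIco 1 0 (b - a)).2.1

lemma ccw_lt_one (a b : S) : ccw a b < 1 :=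
  (AddCircle.equivIco (1 : ℝ) 0 (b - a)).2.2.trans_eq (zero_add 1)

lemma coe_ccw (a b : S) : ((ccw a b : ℝ) : S) = b - a := AddCircle.coe_equivIco

lemma add_ccw (a b : S) : a + ((ccw a b : ℝ) : S) = b := by rw [coe_ccw]; abel

lemma ccw_add_coe (a : S) (h : ℝ) : ccw a (a + (h : S)) = Int.fract h := by
  have := AddCircle.coe_equivIco_mk_apply (1 : ℝ) h
  simp only [div_one, mul_one] at this
  rw [← this, ccw, add_sub_cancel_left]

lemma ccw_add_coe_of_mem (a : S) {h : ℝ} (h0 : 0 ≤ h) (h1 : h < 1) : ccw a (a + (h : S)) = h := by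
  rw [ccw_add_coe, Int.fract_eq_self.2 ⟨h0, h1⟩]

lemma ccw_inj {o a b : S} (h : ccw o a = ccw o b) : a = b := by
  rw [← add_ccw o a, ← add_ccw o b, h]

@[simp] lemma ccw_self (a : S) : ccw a a = 0 := by
  simpa using ccw_add_coe a 0

lemma ccw_pos {a b : S} (h : a ≠ b) : 0 < ccw a b :=
  (ccw_nonneg a b).lt_of_ne fun h0 => h (ccw_inj (o := a) (by rw [ccw_self, h0]))

lemma ccw_eq_fract (o a b : S) : ccw a b = Int.fract (ccw o b - ccw o a) := by
  rw [← ccw_add_coe a]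
  congr 1
  rw [AddCircle.coe_sub, coe_ccw, coe_ccw]
  abel

lemma ccw_of_le {o a b : S} (h : ccw o a ≤ ccw o b) : ccw a b = ccw o b - ccw o a := by
  rw [ccw_eq_fract o, Int.fract_eq_self]
  constructor <;> linarith [ccw_nonneg o a, ccw_lt_one o b]

lemma ccw_of_lt {o a b : S} (h : ccw o b < ccw o a) : ccw a b = ccw o b - ccw o a + 1 := by
  rw [ccw_eq_fract o, ← Int.fract_add_one, Int.fract_eq_self]
  constructor <;> linarith [ccw_nonneg o b, ccw_lt_one o a]

lemma sbtw_iff_ccw_right {a b c : S} : sbtw a b c ↔ 0 < ccw c a ∧ ccw c a < ccw c b := by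
  rw [sbtw_iff_not_btw]
  -- Mathlib's `btw` compares a representative in `[0, 1)` with one in `(0, 1]`. The conventions
  -- differ only at `0`, so `a = c` is a separate case.
  have key : btw c b a ↔ ccw c b ≤ (QuotientAddGroup.equivIocMod (zero_lt_one' ℝ) 0 (a - c) : ℝ) :=
    Iff.rfl
  rw [key, not_le]
  by_cases hac : a = c
  · subst hac
    have h1 : ((QuotientAddGroup.equivIocMod (zero_lt_one' ℝ) 0 (a - a)) : ℝ) = 1 := by
      rw [sub_self, QuotientAddGroup.equivIocMod_zero]
      simp
    rw [h1]
    simp [(ccw_lt_one a b).le]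
  · have hpos := ccw_pos (Ne.symm hac)
    have h1 : ((QuotientAddGroup.equivIocMod (zero_lt_one' ℝ) 0 (a - c)) : ℝ) = ccw c a := by
      rw [← coe_ccw c a]
      erw [QuotientAddGroup.equivIocMod_coe]
      exact (toIocMod_eq_self _).2 ⟨hpos, by linarith [ccw_lt_one c a]⟩
    rw [h1]
    simp [hpos]

/-- The circular order, read off in the coordinate with origin `o`. -/
lemma sbtw_iff_ccw (o : S) {a b c : S} : sbtw a b c ↔
    (ccw o a < ccw o b ∧ ccw o b < ccw o c) ∨ (ccw o b < ccw o c ∧ ccw o c < ccw o a) ∨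
      (ccw o c < ccw o a ∧ ccw o a < ccw o b) := by
  rw [sbtw_iff_ccw_right]
  have ha0 := ccw_nonneg o a
  have hb0 := ccw_nonneg o b
  have hc0 := ccw_nonneg o c
  have ha1 := ccw_lt_one o a
  have hb1 := ccw_lt_one o b
  have hc1 := ccw_lt_one o c
  rcases le_or_gt (ccw o c) (ccw o a) with h1 | h1 <;>
    rcases le_or_gt (ccw o c) (ccw o b) with h2 | h2 <;>
    first | rw [ccw_of_le h1] | rw [ccw_of_lt h1]
  all_goals first | rw [ccw_of_le h2] | rw [ccw_of_lt h2]
  all_goals grind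

lemma sbtw_iff_ccw_left {a b c : S} : sbtw a b c ↔ 0 < ccw a b ∧ ccw a b < ccw a c := by
  rw [sbtw_iff_ccw a, ccw_self]
  have := ccw_nonneg a b
  have := ccw_nonneg a c
  grind

lemma eq_iff_ccw (o : S) {a b : S} : a = b ↔ ccw o a = ccw o b := ⟨fun h => h ▸ rfl, ccw_inj⟩

lemma sbtw_or_sbtw {a b c : S} (hab : a ≠ b) (hbc : b ≠ c) (hac : a ≠ c) :
    sbtw a b c ∨ sbtw c b a := by
  simp only [sbtw_iff_ccw 0, Ne, eq_iff_ccw 0] at *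
  grind

lemma sbtw_ne {a b c : S} (h : sbtw a b c) : a ≠ b ∧ b ≠ c ∧ a ≠ c := by
  simp only [sbtw_iff_ccw 0, Ne, eq_iff_ccw 0] at *
  grind

/-- The coordinate `ccw` jumps only where its two arguments coincide, which strict betweenness
excludes. -/
lemma isOpen_sbtw : IsOpen {p : S × S × S | sbtw p.1 p.2.1 p.2.2} := by
  rw [isOpen_iff_mem_nhds]
  rintro ⟨a, b, c⟩ h
  have h' : sbtw a b c := h
  obtain ⟨hab, -, hac⟩ := sbtw_ne h'
  have cont : ∀ {f g : S × S × S → S}, Continuous f → Continuous g →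
      f (a, b, c) ≠ g (a, b, c) → ContinuousAt (fun p => ccw (f p) (g p)) (a, b, c) := by
    intro f g hf hg hne
    have h1 : ContinuousAt (AddCircle.equivIco (1 : ℝ) 0) (g (a, b, c) - f (a, b, c)) :=
      AddCircle.continuousAt_equivIco 1 0 (by simpa [sub_eq_zero] using hne.symm)
    have h2 : ContinuousAt (fun p : S × S × S => g p - f p) (a, b, c) :=
      (hg.sub hf).continuousAt
    exact continuousAt_subtype_val.comp (ContinuousAt.comp (x := (a, b, c)) h1 h2)
  have c1 := cont (f := fun p => p.1) (g := fun p => p.2.1) (by fun_prop) (by fun_prop) hab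
  have c2 := cont (f := fun p => p.1) (g := fun p => p.2.2) (by fun_prop) (by fun_prop) hac
  rw [sbtw_iff_ccw_left] at h'
  filter_upwards [c1.eventually (lt_mem_nhds h'.1), c1.eventually_lt c2 h'.2] with p hp1 hp2
  exact sbtw_iff_ccw_left.2 ⟨hp1, hp2⟩

lemma isOpen_crosses :
    IsOpen {p : (S × S) × (S × S) | Crosses p.1.1 p.1.2 p.2.1 p.2.2} := by
  have key : ∀ {f g h : (S × S) × (S × S) → S}, Continuous f → Continuous g → Continuous h →
      IsOpen {p | sbtw (f p) (g p) (h p)} := fun hf hg hh =>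
    isOpen_sbtw.preimage (hf.prodMk (hg.prodMk hh))
  refine IsOpen.union (IsOpen.inter ?_ ?_) (IsOpen.inter ?_ ?_) <;>
    exact key (by fun_prop) (by fun_prop) (by fun_prop)

/-! ### The map `sigma` -/

lemma continuous_sigma (d : ℕ) : Continuous (sigma d) := continuous_nsmul d

lemma sigma_add_coe (d : ℕ) (a : S) (h : ℝ) :
    sigma d (a + (h : S)) = sigma d a + ((d * h : ℝ) : S) := by
  simp [sigma, smul_add, ← nsmul_eq_mul]

lemma ccw_sigma (d : ℕ) (a b : S) : ccw (sigma d a) (sigma d b) = Int.fract (d * ccw a b) := by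
  conv_lhs => rw [← add_ccw a b]
  rw [sigma_add_coe, ccw_add_coe]

lemma sigma_surjective {d : ℕ} (hd : 0 < d) : Function.Surjective (sigma d) := by
  intro a
  have hd' : (d : ℝ) ≠ 0 := by exact_mod_cast hd.ne'
  refine ⟨0 + ((ccw 0 a / d : ℝ) : S), ?_⟩
  rw [sigma_add_coe, mul_div_cancel₀ _ hd', show sigma d 0 = 0 from smul_zero d, add_ccw]

/-- The `k`-th of the `d` points with the same image as `a`. -/
noncomputable def rotate (d : ℕ) (a : S) (k : Fin d) : S := a + (((k : ℝ) / d : ℝ) : S)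

lemma sigma_rotate (d : ℕ) (a : S) (k : Fin d) : sigma d (rotate d a k) = sigma d a := by
  have hd : (d : ℝ) ≠ 0 := by have := k.pos; positivity
  rw [rotate, sigma_add_coe, mul_div_cancel₀ _ hd]
  have : (((k : ℕ) : ℝ) : S) = 0 := by
    rw [AddCircle.coe_eq_zero_iff]
    exact ⟨k, by simp⟩
  simp [this]

lemma ccw_rotate (d : ℕ) (a : S) (k : Fin d) : ccw a (rotate d a k) = (k : ℝ) / d := by
  have hd : (0 : ℝ) < d := by exact_mod_cast k.pos
  refine ccw_add_coe_of_mem a (by positivity) ?_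
  rw [div_lt_one hd]
  exact_mod_cast k.2

lemma rotate_injective (d : ℕ) (a : S) : Function.Injective (rotate d a) := by
  intro k l h
  have hd : (d : ℝ) ≠ 0 := by have := k.pos; positivity
  have := congrArg (ccw a) h
  rw [ccw_rotate, ccw_rotate, div_left_inj' hd] at this
  exact Fin.ext (by exact_mod_cast this)

lemma exists_rotate_eq {d : ℕ} (hd : 0 < d) {a w : S} (h : sigma d w = sigma d a) :
    ∃ k, rotate d a k = w := by
  have hd' : (0 : ℝ) < d := by exact_mod_cast hd
  have h1 := ccw_sigma d a w
  rw [h, ccw_self] at h1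
  obtain ⟨n, hn⟩ := Int.fract_eq_zero_iff.1 h1.symm
  have h0 := ccw_nonneg a w
  have h1' := ccw_lt_one a w
  have hn0 : 0 ≤ n := by
    have : (0 : ℝ) ≤ n := by rw [hn]; positivity
    exact_mod_cast this
  have hnd : n < d := by
    have : (n : ℝ) < d := by rw [hn]; nlinarith
    exact_mod_cast this
  lift n to ℕ using hn0
  refine ⟨⟨n, by exact_mod_cast hnd⟩, ccw_inj (o := a) ?_⟩
  rw [ccw_rotate, div_eq_iff hd'.ne', mul_comm]
  simpa using hn

lemma finite_sigma_fiber {d : ℕ} (hd : 0 < d) (x : S) : {w : S | sigma d w = x}.Finite := by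
  obtain ⟨a, rfl⟩ := sigma_surjective hd x
  exact (Set.finite_range (rotate d a)).subset fun w hw => exists_rotate_eq hd hw

/-! ### Sides of finite sets of points -/

lemma Crosses.swap_left {a b c e : S} (h : Crosses a b c e) : Crosses b a c e := by
  unfold Crosses at *; tauto

lemma Crosses.swap_right {a b c e : S} (h : Crosses a b c e) : Crosses a b e c := by
  unfold Crosses at *; tauto

lemma Crosses.symm {a b c e : S} (h : Crosses a b c e) : Crosses c e a b := by
  simp only [Crosses, sbtw_iff_ccw 0] at *
  grind

lemma exists_isSide {V : Set S} (hV : V.Finite) (hn : V.Nontrivial) {a : S} (ha : a ∈ V) :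
    ∃ b, IsSide V a b := by
  obtain ⟨b0, hb0, hne⟩ := hn.exists_ne a
  obtain ⟨b, hb, hmin⟩ := (V \ {a}).exists_min_image (ccw a) (hV.subset sdiff_subset)
    ⟨b0, hb0, hne⟩
  refine ⟨b, ha, hb.1, fun h => hb.2 h.symm, fun c hc hs => ?_⟩
  have := hmin c ⟨hc, fun h => (sbtw_ne hs).1 h.symm⟩
  exact absurd (sbtw_iff_ccw_left.1 hs).2 this.not_gt

lemma IsSide.right_unique {V : Set S} {a b c : S} (h : IsSide V a b) (h' : IsSide V a c) :
    b = c := by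
  obtain ⟨-, hb, hab, h⟩ := h
  obtain ⟨-, hc, hac, h'⟩ := h'
  have h1 := h c hc
  have h2 := h' b hb
  simp only [sbtw_iff_ccw 0, Ne, eq_iff_ccw 0] at *
  grind

lemma IsSide.left_unique {V : Set S} {a b c : S} (h : IsSide V a c) (h' : IsSide V b c) :
    a = b := by
  obtain ⟨ha, -, hac, h⟩ := h
  obtain ⟨hb, -, hbc, h'⟩ := h'
  have h1 := h b hb
  have h2 := h' a ha
  simp only [sbtw_iff_ccw 0, Ne, eq_iff_ccw 0] at *
  grind

lemma IsSide.sbtw {V : Set S} {a b c : S} (h : IsSide V a b) (h' : IsSide V b c) (hac : a ≠ c) :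
    sbtw a b c := by
  obtain ⟨-, hb, hab, h⟩ := h
  obtain ⟨-, hc, hbc, h'⟩ := h'
  have h1 := h c hc
  simp only [sbtw_iff_ccw 0, Ne, eq_iff_ccw 0] at *
  grind

/-- A nonempty subset that contains the successor of each of its points is everything. -/
lemma subset_of_isSide_closed {V A : Set S} (hV : V.Finite) (hn : V.Nontrivial) (hA : A ⊆ V)
    (hne : A.Nonempty) (hcl : ∀ a b, a ∈ A → IsSide V a b → b ∈ A) : V ⊆ A := by
  intro p hp
  by_contra hpA
  obtain ⟨a, ha, hmin⟩ := A.exists_min_image (fun a => ccw a p) (hV.subset hA) hne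
  obtain ⟨b, hb⟩ := exists_isSide hV hn (hA ha)
  have hbA := hcl a b ha hb
  have hle : ccw a p ≤ ccw b p := hmin b hbA
  have hap : a ≠ p := fun h => hpA (h ▸ ha)
  have hbp : b ≠ p := fun h => hpA (h ▸ hbA)
  have h1 := hb.2.2.2 p hp
  rw [sbtw_iff_ccw_left, not_and, not_lt] at h1
  have h2 := h1 (ccw_pos hap)
  rw [ccw_of_le h2] at hle
  linarith [ccw_pos hb.2.2.1]

/-- Here `p` is the last vertex before `g`; its successor cannot come before `g` as well. -/
lemma exists_isSide_sbtw {V : Set S} (hV : V.Finite) (hn : V.Nontrivial) {g : S} (hg : g ∉ V) :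
    ∃ p q, IsSide V p q ∧ sbtw p g q := by
  obtain ⟨p, hp, hmin⟩ := V.exists_min_image (fun a => ccw a g) hV hn.nonempty
  obtain ⟨q, hq⟩ := exists_isSide hV hn hp
  refine ⟨p, q, hq, ?_⟩
  have hle : ccw p g ≤ ccw q g := hmin q hq.2.1
  have hpg : p ≠ g := fun h => hg (h ▸ hp)
  rw [sbtw_iff_ccw_left]
  refine ⟨ccw_pos hpg, ?_⟩
  by_contra! h
  rw [ccw_of_le h] at hle
  linarith [ccw_pos hq.2.2.1]

/-! ### Orientation of images in an invariant lamination -/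

/-- The siblings of a leaf `ab` match the points over `σ_d(a)` with the points over `σ_d(b)`. -/
lemma Lamination.IsInvariant.exists_matching {d : ℕ} (hd : 0 < d) {L : Lamination}
    (hL : L.IsInvariant d) {a b : S} (hab : s(a, b) ∈ L.chords) (hne : sigma d a ≠ sigma d b) :
    ∃ g : S → S, g a = b ∧
      (∀ w, sigma d w = sigma d a → s(w, g w) ∈ L.chords ∧ sigma d (g w) = sigma d b) ∧
      ∀ w w', sigma d w = sigma d a → sigma d w' = sigma d a → g w = g w' → w = w' := by
  obtain ⟨m, ⟨i₀, hi₀⟩, hm, hdisj⟩ := hL.exists_siblings _ hab (by simpa [sigmaChord] using hne)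
  have hpq : ∀ i, ∃ p q, m i = s(p, q) ∧ sigma d p = sigma d a ∧ sigma d q = sigma d b := by
    intro i
    have h := (hm i).2
    induction hmi : m i using Sym2.ind with
    | _ p q =>
      rw [hmi] at h
      simp only [sigmaChord, Sym2.map_mk, Sym2.eq_iff] at h
      rcases h with h | h
      · exact ⟨p, q, rfl, h⟩
      · exact ⟨q, p, Sym2.eq_swap, h.2, h.1⟩
  choose p q hmpq hp hq using hpq
  have hpinj : Function.Injective p := by
    intro i j hij
    by_contra hne
    exact hdisj i j hne (p i) ⟨by simp [hmpq i], by simp [hmpq j, hij]⟩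
  have hqinj : Function.Injective q := by
    intro i j hij
    by_contra hne
    exact hdisj i j hne (q i) ⟨by simp [hmpq i], by simp [hmpq j, hij]⟩
  -- Disjointness makes the `d` endpoints `p i` distinct, and the fibre has only `d` points, so they
  -- exhaust it.
  have hsurj : ∀ w, sigma d w = sigma d a → ∃ i, p i = w := by
    choose k hk using fun i => exists_rotate_eq hd (hp i)
    have hk_inj : Function.Injective k := fun i j hij => hpinj (by rw [← hk i, ← hk j, hij])
    intro w hw
    obtain ⟨l, rfl⟩ := exists_rotate_eq hd hw
    obtain ⟨i, hi⟩ := (Finite.injective_iff_surjective.1 hk_inj) l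
    exact ⟨i, by rw [← hk i, hi]⟩
  have : Nonempty (Fin d) := ⟨i₀⟩
  choose! i hi using hsurj
  refine ⟨fun w => q (i w), ?_, fun w hw => ⟨?_, hq _⟩, fun w w' hw hw' h => ?_⟩
  · have h1 : s(a, b) = s(p i₀, q i₀) := by rw [← hmpq, hi₀]
    have h2 : a = p i₀ ∧ b = q i₀ := by
      rcases Sym2.eq_iff.1 h1 with h | h
      · exact h
      · exact absurd (by rw [h.1, hq]) hne
    have h3 : i a = i₀ := hpinj (by rw [hi a rfl, h2.1])
    simp only [h3, h2.2]
  · have := (hm (i w)).1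
    rwa [hmpq, hi w hw] at this
  · rw [← hi w hw, ← hi w' hw', hqinj h]

/-- Let `uv` be a leaf and let `cu` belong to a matching `g` by leaves of the points over `σ_d(c)`
with the points over `σ_d(u)`, where `σ_d(c)` is in the arc from `σ_d(u)` to `σ_d(v)` but `c` is
not in the arc from `u` to `v`. Then `σ_d(c) = σ_d(v)`, and `g v` is not in that arc either. -/
lemma Lamination.matching_leaves_arc {d : ℕ} (hd : 0 < d) {L : Lamination} {u v c : S} {g : S → S}
    (huv : s(u, v) ∈ L.chords) (hgc : g c = u)
    (hg : ∀ w, sigma d w = sigma d c → s(w, g w) ∈ L.chords ∧ sigma d (g w) = sigma d u)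
    (hinj : ∀ w w', sigma d w = sigma d c → sigma d w' = sigma d c → g w = g w' → w = w')
    (hpos : 0 < ccw (sigma d u) (sigma d c))
    (hle : ccw (sigma d u) (sigma d c) ≤ ccw (sigma d u) (sigma d v))
    (hc : ccw u v < ccw u c) :
    sigma d c = sigma d v ∧ ccw u v < ccw u (g v) := by
  have hd' : (0 : ℝ) < d := by exact_mod_cast hd
  have hsuv : sigma d u ≠ sigma d v := by
    intro h
    rw [← h, ccw_self] at hle
    linarith
  have huv_pos : 0 < ccw u v := ccw_pos fun h => hsuv (h ▸ rfl)
  suffices hex : ∃ w, sigma d w = sigma d c ∧ 0 < ccw u w ∧ ccw u w ≤ ccw u v ∧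
      ccw u v < ccw u (g w) by
    obtain ⟨w, hw, h0, hwv, hgw⟩ := hex
    -- A leaf from the open arc to a point beyond `v` would cross `uv`.
    have hwv' : w = v := by
      by_contra hne
      refine L.not_crosses u v w (g w) huv (hg w hw).1 (Or.inl ⟨?_, ?_⟩)
      · exact sbtw_iff_ccw_left.2 ⟨h0, hwv.lt_of_ne fun h => hne (ccw_inj h)⟩
      · rw [sbtw_iff_ccw u, ccw_self]
        grind
    subst hwv'
    exact ⟨hw.symm, hgw⟩
  by_contra! hall
  -- Otherwise all matching leaves from points over `σ_d(c)` in the arc stay in it. Translation by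
  -- `δ` takes the points `Y` over `σ_d(u)` in the arc to such points, so `w ↦ g (w + δ)` is an
  -- injection of the finite set `Y` into itself. It must hit `u`, but `u` is matched with `c`,
  -- outside the arc.
  set δ : ℝ := ccw (sigma d u) (sigma d c) / d with hδ
  have hdδ : d * δ = ccw (sigma d u) (sigma d c) := by rw [hδ]; field_simp
  have hδ0 : 0 < δ := div_pos hpos hd'
  let Y : Set S := {w | sigma d w = sigma d u ∧ ccw u w < ccw u v}
  have hY : Y.Finite := (finite_sigma_fiber hd (sigma d u)).subset fun w hw => hw.1
  have hτ : ∀ w ∈ Y, sigma d (w + (δ : S)) = sigma d c ∧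
      ccw u (w + (δ : S)) = ccw u w + δ ∧ ccw u w + δ ≤ ccw u v := by
    rintro w ⟨hw, hwv⟩
    have h1 : ccw w v = ccw u v - ccw u w := ccw_of_le hwv.le
    have h2 : Int.fract (d * ccw w v) = ccw (sigma d u) (sigma d v) := by rw [← ccw_sigma, hw]
    have h3 : Int.fract (d * ccw w v) ≤ d * ccw w v := by
      have : (0 : ℝ) ≤ ⌊d * ccw w v⌋ := by
        exact_mod_cast Int.floor_nonneg.2 (mul_nonneg hd'.le (ccw_nonneg w v))
      linarith [Int.fract_add_floor (d * ccw w v)]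
    have h4 : d * δ ≤ d * ccw w v := by linarith
    have h5 : δ ≤ ccw w v := le_of_mul_le_mul_left h4 hd'
    refine ⟨?_, ?_, by linarith⟩
    · rw [sigma_add_coe, hw, hdδ, add_ccw]
    · have h6 : w + (δ : S) = u + ((ccw u w + δ : ℝ) : S) := by
        rw [AddCircle.coe_add, ← add_assoc, add_ccw]
      rw [h6]
      exact ccw_add_coe_of_mem _ (by linarith [ccw_nonneg u w]) (by linarith [ccw_lt_one u v])
  have hmaps : ∀ w ∈ Y, g (w + (δ : S)) ∈ Y ∧ g (w + (δ : S)) ≠ u := by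
    intro w hw
    obtain ⟨h1, h2, h3⟩ := hτ w hw
    have hlow : 0 < ccw u (w + (δ : S)) := by rw [h2]; linarith [ccw_nonneg u w]
    have hup : ccw u (w + (δ : S)) ≤ ccw u v := by rw [h2]; exact h3
    have h4 := hall _ h1 hlow hup
    have h5 := (hg _ h1).2
    refine ⟨⟨h5, h4.lt_of_ne fun h => hsuv ?_⟩, fun h => ?_⟩
    · rw [← h5, ccw_inj h]
    · have := hinj _ _ h1 rfl (h.trans hgc.symm)
      rw [this] at hup
      linarith
  have hinjOn : InjOn (fun w => g (w + (δ : S))) Y := by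
    intro w hw w' hw' h
    exact add_right_cancel (hinj _ _ (hτ w hw).1 (hτ w' hw').1 h)
  have huY : u ∈ Y := ⟨rfl, by simpa using huv_pos⟩
  obtain ⟨w, hw, hwu⟩ := ((hY.injOn_iff_bijOn_of_mapsTo fun w hw => (hmaps w hw).1).1 hinjOn).surjOn huY
  exact (hmaps w hw).2 hwu

/-- Otherwise `c` is beyond `a` as seen from `b`, and `matching_leaves_arc` for the leaf `ba` forces
`σ_d(c) = σ_d(a)`. -/
lemma Lamination.IsInvariant.sbtw_of_sbtw_sigma {d : ℕ} (hd : 0 < d) {L : Lamination}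
    (hL : L.IsInvariant d) {a b c : S} (hab : s(a, b) ∈ L.chords) (hbc : s(b, c) ∈ L.chords)
    (h : sbtw (sigma d a) (sigma d b) (sigma d c)) : sbtw a b c := by
  obtain ⟨h1, h2, h3⟩ := sbtw_ne h
  obtain ⟨g, hgc, hg, hinj⟩ := hL.exists_matching hd (Sym2.eq_swap ▸ hbc) h2.symm
  have hs := sbtw_iff_ccw_left.1 (sbtw_cyclic_left h)
  have hle : ccw b c ≤ ccw b a := by
    by_contra! hlt
    exact h3 (L.matching_leaves_arc hd (Sym2.eq_swap ▸ hab) hgc hg hinj hs.1 hs.2.le hlt).1.symm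
  have hlt : ccw b c < ccw b a := hle.lt_of_ne fun h => h3 (by rw [ccw_inj h])
  exact sbtw_cyclic_right (sbtw_iff_ccw_left.2 ⟨ccw_pos fun h => h2 (h ▸ rfl), hlt⟩)

/-- If the vertices `b, c, c'` of a path of leaves are in counterclockwise order and `b`, `c'` have
the same image, then there is another leaf over that of `bc` at `c'`, outside the arc `cc'`. -/
lemma Lamination.IsInvariant.exists_leaf_outside {d : ℕ} (hd : 0 < d) {L : Lamination}
    (hL : L.IsInvariant d) {b c c' : S} (hbc : s(b, c) ∈ L.chords) (hcc : s(c, c') ∈ L.chords)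
    (hne : sigma d b ≠ sigma d c) (heq : sigma d c' = sigma d b) (h : sbtw b c c') :
    ∃ w, s(c', w) ∈ L.chords ∧ sigma d w = sigma d c ∧ ccw c c' < ccw c w := by
  obtain ⟨g, hgc, hg, hinj⟩ := hL.exists_matching hd hbc hne
  refine ⟨g c', (hg c' heq).1, (hg c' heq).2, ?_⟩
  refine (L.matching_leaves_arc hd hcc hgc hg hinj (ccw_pos hne.symm) (by rw [heq]) ?_).2
  exact (sbtw_iff_ccw_left.1 (sbtw_cyclic_left h)).2

/-! ### Polygons of an invariant lamination map forward as positive coverings. -/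

section Forward

variable {d : ℕ} {L : Lamination} {P Q : Polygon}

lemma Lamination.HasPolygon.side_mem (hP : L.HasPolygon P) {a b : S}
    (h : IsSide P.vertices a b) : s(a, b) ∈ L.chords :=
  (hP a h.1 b h.2.1 h.2.2.1).2 (Or.inl h)

lemma Lamination.IsInvariant.isSide_sigma_or (hL : L.IsInvariant d)
    (hP : L.HasPolygon P) (hQ : L.HasPolygon Q) (hPQ : Q.vertices = sigma d '' P.vertices)
    (hside : ∀ a b, IsSide P.vertices a b → sigma d a ≠ sigma d b) {a b : S}
    (h : IsSide P.vertices a b) :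
    IsSide Q.vertices (sigma d a) (sigma d b) ∨ IsSide Q.vertices (sigma d b) (sigma d a) := by
  have hne := hside a b h
  have ha : sigma d a ∈ Q.vertices := hPQ ▸ mem_image_of_mem _ h.1
  have hb : sigma d b ∈ Q.vertices := hPQ ▸ mem_image_of_mem _ h.2.1
  refine (hQ _ ha _ hb hne).1 ?_
  rcases hL.image_mem _ (hP.side_mem h) with h1 | h1
  · simpa [sigmaChord] using h1
  · exact absurd (by simpa [sigmaChord] using h1) hne

/-- A side that is mapped backwards is followed by a side that is mapped back again. -/
lemma Lamination.IsInvariant.alternate_of_isSide_swap (hd : 0 < d) (hL : L.IsInvariant d)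
    (hP : L.HasPolygon P) (hQ : L.HasPolygon Q) (hPQ : Q.vertices = sigma d '' P.vertices)
    (hside : ∀ a b, IsSide P.vertices a b → sigma d a ≠ sigma d b) {b c c' e : S}
    (hbc : IsSide P.vertices b c) (hcc : IsSide P.vertices c c') (hce : IsSide P.vertices c' e)
    (h : IsSide Q.vertices (sigma d c) (sigma d b))
    (hnot : ¬ IsSide Q.vertices (sigma d b) (sigma d c)) :
    sigma d c' = sigma d b ∧ sigma d e = sigma d c := by
  have mem_swap : ∀ {a b}, IsSide P.vertices a b → s(b, a) ∈ L.chords := fun h =>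
    Sym2.eq_swap ▸ hP.side_mem h
  have hc' : sigma d c' = sigma d b := by
    -- If the images of `c'`, `c`, `b` were distinct and in positive order, `c'`, `c`, `b` would be
    -- too, against their order on `P`.
    rcases hL.isSide_sigma_or hP hQ hPQ hside hcc with h1 | h1
    · exact h1.right_unique h
    · by_contra hne
      have hs := hL.sbtw_of_sbtw_sigma hd (mem_swap hcc) (mem_swap hbc) (h1.sbtw h hne)
      exact sbtw_asymm hs (hbc.sbtw hcc fun h => hne (h ▸ rfl))
  refine ⟨hc', ?_⟩
  rcases hL.isSide_sigma_or hP hQ hPQ hside hce with h1 | h1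
  swap
  · rw [hc'] at h1
    exact h1.left_unique h
  by_contra hne
  have hbc' : b ≠ c' := by
    rintro rfl
    exact hne (hce.right_unique hbc ▸ rfl)
  -- The leaf `c'w` avoids the arc from `c` to `c'`, and the order `w, c', e` shown next keeps it
  -- off the arc from `c'` to `e`. So it enters the interior of `P`, where it is a diagonal or
  -- crosses a side.
  obtain ⟨w, hw, hwc, hlt⟩ := hL.exists_leaf_outside hd (hP.side_mem hbc) (hP.side_mem hcc)
    (hside _ _ hbc) hc' (hbc.sbtw hcc hbc')
  have hs : sbtw w c' e := by
    refine hL.sbtw_of_sbtw_sigma hd (Sym2.eq_swap ▸ hw) (hP.side_mem hce) ?_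
    rw [hwc, hc']
    rw [hc'] at h1
    exact h.sbtw h1 (Ne.symm hne)
  have hwcc : ¬ sbtw c w c' := fun h => absurd (sbtw_iff_ccw_left.1 h).2 hlt.not_gt
  by_cases hwP : w ∈ P.vertices
  · rcases (hP c' hce.1 w hwP (sbtw_ne hs).1.symm).1 hw with h2 | h2
    · exact (sbtw_ne hs).2.2 (h2.right_unique hce)
    · have := h2.left_unique hcc
      subst this
      rw [ccw_self] at hlt
      exact absurd hlt (ccw_nonneg _ _).not_gt
  · obtain ⟨p, q, hpq, hpwq⟩ := exists_isSide_sbtw P.finite P.nontrivial hwP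
    have hp : p ≠ c' := by
      rintro rfl
      rw [hpq.right_unique hce] at hpwq
      exact sbtw_asymm hpwq (sbtw_cyclic_right hs)
    have hq : q ≠ c' := by
      rintro rfl
      rw [hpq.left_unique hcc] at hpwq
      exact hwcc hpwq
    have hqp : sbtw q c' p :=
      (sbtw_or_sbtw hp hq.symm hpq.2.2.1).resolve_left (hpq.2.2.2 c' hce.1)
    exact L.not_crosses p q w c' (hP.side_mem hpq) (Sym2.eq_swap ▸ hw) (Or.inl ⟨hpwq, hqp⟩)

theorem Lamination.IsInvariant.mapsAsPositiveCovering (hd : 0 < d) (hL : L.IsInvariant d)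
    (hP : L.HasPolygon P) (hQ : L.HasPolygon Q) (hPQ : Q.vertices = sigma d '' P.vertices)
    (hside : ∀ a b, IsSide P.vertices a b → sigma d a ≠ sigma d b) :
    P.MapsAsPositiveCovering d := by
  intro b c hbc
  rw [← hPQ]
  by_contra hnot
  have h := (hL.isSide_sigma_or hP hQ hPQ hside hbc).resolve_left hnot
  -- The invariant carried around `P`: vertices alternate between the fibres of `σ_d(b)` and
  -- `σ_d(c)`. Then the image has no third vertex, contrary to `hnot`.
  let A : Set S := {v | v ∈ P.vertices ∧ ((sigma d v = sigma d b ∧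
      ∀ v', IsSide P.vertices v v' → sigma d v' = sigma d c) ∨
    (sigma d v = sigma d c ∧ ∃ u, IsSide P.vertices u v ∧ sigma d u = sigma d b))}
  have hA : P.vertices ⊆ A := by
    refine subset_of_isSide_closed P.finite P.nontrivial (fun v hv => hv.1)
      ⟨b, hbc.1, Or.inl ⟨rfl, fun v' hv' => hv'.right_unique hbc ▸ rfl⟩⟩ ?_
    rintro v v' ⟨-, hv | ⟨hv, u, huv, hu⟩⟩ hvv'
    · exact ⟨hvv'.2.1, Or.inr ⟨hv.2 v' hvv', v, hvv', hv.1⟩⟩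
    · rw [← hu, ← hv] at hnot h
      obtain ⟨e, he⟩ := exists_isSide P.finite P.nontrivial hvv'.2.1
      have key := fun e he =>
        hL.alternate_of_isSide_swap hd hP hQ hPQ hside (e := e) huv hvv' he h hnot
      exact ⟨hvv'.2.1, Or.inl ⟨(key e he).1.trans hu, fun e he => (key e he).2.trans hv⟩⟩
  refine hnot ⟨h.2.1, h.1, h.2.2.1.symm, fun q hq hs => ?_⟩
  rw [hPQ] at hq
  obtain ⟨v, hv, rfl⟩ := hq
  rcases (hA hv).2 with h1 | h1
  · exact (sbtw_ne hs).1 h1.1.symm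
  · exact (sbtw_ne hs).2.1 h1.1

end Forward

/-! ### Pulling polygons back -/

lemma Polygon.IsDisjoint.symm {P Q : Polygon} (h : P.IsDisjoint Q) : Q.IsDisjoint P :=
  ⟨h.1.symm, fun a ha b hb c hc e he hx => h.2 c hc e he a ha b hb hx.symm⟩

/-- If `ab` separates `v` from `w`, then `u`, lying on one side of it, is separated from one of
them. -/
lemma Crosses.of_left {a b u v w : S} (h : Crosses a b v w) (ha : u ≠ a) (hb : u ≠ b) :
    Crosses a b u v ∨ Crosses a b u w := by
  simp only [Crosses, sbtw_iff_ccw 0, Ne, eq_iff_ccw 0] at *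
  grind

/-- `w` is not a vertex of a polygon of `𝓐` and is not separated from `u` by such a polygon. -/
def Sees (𝓐 : Set Polygon) (u w : S) : Prop :=
  ∀ A ∈ 𝓐, w ∉ A.vertices ∧ ∀ a ∈ A.vertices, ∀ b ∈ A.vertices, ¬ Crosses a b u w

lemma not_crosses_self {a b u : S} : ¬ Crosses a b u u := by
  rintro (h | h) <;> exact sbtw_asymm h.1 h.2

/-- Taking `w = u` gives symmetry, so visibility is an equivalence relation off the vertices. -/
lemma Sees.trans {𝓐 : Set Polygon} {u v w : S} (huv : Sees 𝓐 u v) (huw : Sees 𝓐 u w)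
    (hu : ∀ A ∈ 𝓐, u ∉ A.vertices) : Sees 𝓐 v w := by
  refine fun A hA => ⟨(huw A hA).1, fun a ha b hb h => ?_⟩
  rcases h.of_left (u := u) (fun h => hu A hA (h ▸ ha)) (fun h => hu A hA (h ▸ hb)) with h | h
  · exact (huv A hA).2 a ha b hb h
  · exact (huw A hA).2 a ha b hb h

/-- If no point over `y` lies between `u + e` and `u + T` and the image of `u + e` is in the arc
`[x, y)`, then the image of `u + T` is in the arc `(x, y]`. -/
lemma sigma_mem_Ioc_of_mem_Ico {d : ℕ} (hd : 0 < d) {u x y : S} {e T : ℝ} (heT : e < T)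
    (hx : ccw x (sigma d (u + (e : S))) < ccw x y)
    (hy : ∀ h : ℝ, e < h → h < T → sigma d (u + (h : S)) ≠ y) :
    sigma d (u + (T : S)) ≠ x ∧ ccw x (sigma d (u + (T : S))) ≤ ccw x y := by
  have hd' : (0 : ℝ) < d := by exact_mod_cast hd
  set α := ccw x (sigma d (u + (e : S))) with hα
  set β := ccw x y with hβ
  have hα0 : 0 ≤ α := ccw_nonneg _ _
  have hβ1 : β < 1 := ccw_lt_one _ _
  have shift : ∀ t : ℝ, sigma d (u + ((e + t : ℝ) : S)) = x + ((α + d * t : ℝ) : S) := by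
    intro t
    rw [AddCircle.coe_add, ← add_assoc, sigma_add_coe, AddCircle.coe_add, ← add_assoc, hα,
      add_ccw]
  -- Otherwise the image reaches `y` at parameter `e + (β - α) / d`, before `T`.
  have hle : d * (T - e) ≤ β - α := by
    by_contra! hlt
    have h0 : 0 < (β - α) / d := div_pos (by linarith) hd'
    refine hy (e + (β - α) / d) (by linarith) ?_ ?_
    · have : (β - α) / d < T - e := by rw [div_lt_iff₀ hd']; linarith
      linarith
    · rw [shift, mul_div_cancel₀ _ hd'.ne', add_sub_cancel, hβ, add_ccw]
  have hT := shift (T - e)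
  rw [add_sub_cancel] at hT
  have hpos : 0 < d * (T - e) := mul_pos hd' (by linarith)
  have hccw : ccw x (sigma d (u + (T : S))) = α + d * (T - e) := by
    rw [hT]
    exact ccw_add_coe_of_mem _ (by linarith) (by linarith)
  refine ⟨fun h => ?_, by linarith⟩
  rw [h, ccw_self] at hccw
  linarith

/-- For `u` off the polygon, `ts` is the side facing `u`: a counterclockwise walk meets the polygon
first at `s` and leaves it at `t`. -/
lemma Polygon.exists_extremes (A : Polygon) (u : S) : ∃ s t, IsSide A.vertices t s ∧
    ∀ a ∈ A.vertices, ccw u s ≤ ccw u a ∧ ccw u a ≤ ccw u t := by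
  obtain ⟨s, hs, hmin⟩ := A.vertices.exists_min_image (ccw u) A.finite A.nontrivial.nonempty
  obtain ⟨t, ht, hmax⟩ := A.vertices.exists_max_image (ccw u) A.finite A.nontrivial.nonempty
  refine ⟨s, t, ⟨ht, hs, ?_, fun c hc h => ?_⟩, fun a ha => ⟨hmin a ha, hmax a ha⟩⟩
  · rintro rfl
    obtain ⟨b, hb, hne⟩ := A.nontrivial.exists_ne t
    exact hne (ccw_inj (le_antisymm (hmax b hb) (hmin b hb)))
  · have h1 := hmin c hc
    have h2 := hmax c hc
    rw [sbtw_iff_ccw u] at h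
    grind

/-- Walking counterclockwise from `u`, along the circle and along the sides of the polygons in `𝓐`
that are met, one does not leave the preimage of the arc from `σ_d(u)` to `y` before one meets a
point over `y`. -/
lemma sigma_mem_Ioc_of_walk {d : ℕ} (hd : 0 < d) {𝓐 : Set Polygon} (hfin : 𝓐.Finite)
    (hdisj : ∀ P ∈ 𝓐, ∀ Q ∈ 𝓐, P ≠ Q → P.IsDisjoint Q) {u y : S}
    (hu : ∀ A ∈ 𝓐, u ∉ A.vertices) (huy : sigma d u ≠ y)
    (hside : ∀ A ∈ 𝓐, ∀ a b, IsSide A.vertices a b → sigma d b ≠ sigma d u →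
      ccw (sigma d u) (sigma d b) ≤ ccw (sigma d u) y →
      ccw (sigma d u) (sigma d a) < ccw (sigma d u) y)
    {T : ℝ} (hT0 : 0 < T) (hT1 : T ≤ 1)
    (hy : ∀ h : ℝ, 0 < h → h < T → Sees 𝓐 u (u + (h : S)) → sigma d (u + (h : S)) ≠ y)
    (hvis : ∀ A ∈ 𝓐, ∀ a ∈ A.vertices, ∀ b ∈ A.vertices, ccw u a < T → ccw u b < T) :
    sigma d (u + (T : S)) ≠ sigma d u ∧
      ccw (sigma d u) (sigma d (u + (T : S))) ≤ ccw (sigma d u) y := by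
  choose s t hst hext using fun A : Polygon => A.exists_extremes u
  -- Induction on the number of polygons lying wholly before `T`.
  induction hn : {A ∈ 𝓐 | ccw u (t A) < T}.ncard using Nat.strong_induction_on generalizing T with
  | _ n ih =>
  have hEfin : {A ∈ 𝓐 | ccw u (t A) < T}.Finite := hfin.subset (sep_subset _ _)
  -- The last stretch of the walk, from `e` to `T`, runs on the circle: no polygon has a vertex
  -- there, so all its points are seen from `u`.
  have step : ∀ e : ℝ, 0 ≤ e → e < T → ccw (sigma d u) (sigma d (u + (e : S))) < ccw (sigma d u) y →
      (∀ A ∈ 𝓐, ccw u (t A) < T → ccw u (t A) ≤ e) →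
      sigma d (u + (T : S)) ≠ sigma d u ∧
        ccw (sigma d u) (sigma d (u + (T : S))) ≤ ccw (sigma d u) y := by
    intro e he0 heT hσ hmax
    refine sigma_mem_Ioc_of_mem_Ico hd heT hσ fun h heh hhT => hy h (by linarith) hhT ?_
    have hccw : ccw u (u + (h : S)) = h := ccw_add_coe_of_mem u (by linarith) (by linarith)
    have hmax' : ∀ A ∈ 𝓐, ∀ a ∈ A.vertices, ccw u a < T → ∀ b ∈ A.vertices, ccw u b ≤ e := by
      intro A hA a ha haT b hb
      exact ((hext A) b hb).2.trans (hmax A hA (hvis A hA a ha _ (hst A).1 haT))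
    refine fun A hA => ⟨fun hmem => ?_, fun a ha b hb hx => ?_⟩
    · have := hmax' A hA _ hmem (by rwa [hccw]) _ hmem
      linarith
    · have h1 := hmax' A hA a ha
      have h2 := hmax' A hA b hb
      simp only [Crosses, sbtw_iff_ccw u, ccw_self, hccw] at hx
      have h4 := fun h => h1 h b hb
      have h5 := fun h => h2 h a ha
      have := ccw_nonneg u a
      have := ccw_nonneg u b
      clear h1 h2
      grind
  by_cases hE : {A ∈ 𝓐 | ccw u (t A) < T}.Nonempty
  -- `A` is the polygon left last. Induction treats the walk up to its first vertex `s A`, and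
  -- `hside` carries the conclusion across the side to `t A`.
  · obtain ⟨A, ⟨hA, hAT⟩, hmax⟩ := exists_max_image _ (fun A => ccw u (t A)) hEfin hE
    refine step (ccw u (t A)) (ccw_nonneg _ _) hAT ?_ fun B hB hBT => hmax B ⟨hB, hBT⟩
    rw [add_ccw]
    have hs0 : 0 < ccw u (s A) := ccw_pos fun h => hu A hA (h ▸ (hst A).2.1)
    have hs_lt : ccw u (s A) < ccw u (t A) :=
      (hext A _ (hst A).1).1.lt_of_ne fun h => (hst A).2.2.1 (ccw_inj h).symm
    have key := ih _ ?_ hs0 (ccw_lt_one _ _).le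
      (fun h h0 hlt => hy h h0 (by linarith)) ?_ rfl
    · rw [add_ccw] at key
      exact hside A hA _ _ (hst A) key.1 key.2
    · rw [← hn]
      refine ncard_lt_ncard ⟨fun B hB => ⟨hB.1, hB.2.trans (by linarith)⟩, fun hsub => ?_⟩ hEfin
      exact absurd (hsub ⟨hA, hAT⟩).2 hs_lt.not_gt
    -- A polygon with vertices on both sides of `s A` would cross the side of `A` facing `u`, since
    -- by maximality it ends before `t A`.
    · intro B hB a ha b hb hlt
      by_contra! hle
      by_cases hBA : B = A
      · subst hBA
        exact absurd (hext B a ha).1 hlt.not_ge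
      · have hdj := hdisj B hB A hA hBA
        have hbs : ccw u (s A) ≠ ccw u b := fun h =>
          disjoint_left.1 hdj.1 hb (ccw_inj h ▸ (hst A).2.1)
        have hbT := hvis B hB a ha _ (hst B).1 (by linarith)
        have h1 := hmax B ⟨hB, hbT⟩
        have h2 := (hext B b hb).2
        have hbt : ccw u (t A) ≠ ccw u b := fun h =>
          disjoint_left.1 hdj.1 hb (ccw_inj h ▸ (hst A).1)
        refine hdj.2 a ha b hb _ (hst A).2.1 _ (hst A).1 ?_
        simp only [Crosses, sbtw_iff_ccw u]
        grind
  · rw [not_nonempty_iff_eq_empty] at hE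
    refine step 0 le_rfl hT0 ?_ fun A hA hAT => ?_
    · simpa using ccw_pos huy
    · exact absurd (show A ∈ {A ∈ 𝓐 | ccw u (t A) < T} from ⟨hA, hAT⟩) (by simp [hE])

/-- A finite set of disjoint polygons, each of which is mapped onto a polygon of `𝓑` as a positively
oriented covering. -/
structure Covers (d : ℕ) (𝓐 𝓑 : Set Polygon) : Prop where
  finite : 𝓐.Finite
  disjoint : ∀ P ∈ 𝓐, ∀ Q ∈ 𝓐, P ≠ Q → P.IsDisjoint Q
  covering : ∀ A ∈ 𝓐, A.MapsAsPositiveCovering d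
  image_mem : ∀ A ∈ 𝓐, ∃ B ∈ 𝓑, B.vertices = sigma d '' A.vertices

/-- If `A` maps onto `Q`, no vertex of `Q` lies between `x` and `y`, so `ab` maps to `xy`. Otherwise
the image of `A` is disjoint from `Q` and cannot cross `xy`. -/
lemma Covers.ccw_lt_of_isSide {d : ℕ} {𝓐 𝓑 : Set Polygon} (h : Covers d 𝓐 𝓑)
    (h𝓑 : ∀ P ∈ 𝓑, ∀ Q ∈ 𝓑, P ≠ Q → P.IsDisjoint Q) {Q A : Polygon} (hQ : Q ∈ 𝓑) (hA : A ∈ 𝓐)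
    {x y a b : S} (hxy : IsSide Q.vertices x y) (hab : IsSide A.vertices a b)
    (hbx : sigma d b ≠ x) (hle : ccw x (sigma d b) ≤ ccw x y) :
    ccw x (sigma d a) < ccw x y := by
  obtain ⟨B, hB, hBA⟩ := h.image_mem A hA
  have hab' := h.covering A hA a b hab
  rw [← hBA] at hab'
  by_cases hBQ : B = Q
  · subst hBQ
    have hby : sigma d b = y := by
      by_contra hne
      exact hxy.2.2.2 _ hab'.2.1
        (sbtw_iff_ccw_left.2 ⟨ccw_pos hbx.symm, hle.lt_of_ne fun h => hne (ccw_inj h)⟩)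
    rw [hby] at hab'
    rw [hab'.left_unique hxy, ccw_self]
    exact ccw_pos hxy.2.2.1
  · have hdj := h𝓑 B hB Q hQ hBQ
    have hb0 := ccw_pos hbx.symm
    have hne : ∀ p ∈ B.vertices, ccw x p ≠ ccw x y := fun p hp h =>
      disjoint_left.1 hdj.1 hp (ccw_inj h ▸ hxy.2.1)
    have hax : sigma d a ≠ x := fun h => disjoint_left.1 hdj.1 hab'.1 (h ▸ hxy.1)
    have h1 := hne _ hab'.1
    have h2 := hne _ hab'.2.1
    have h3 := hdj.2 _ hab'.2.1 _ hab'.1 x hxy.1 y hxy.2.1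
    by_contra! hlt
    refine h3 (Crosses.symm ?_)
    simp only [Crosses, sbtw_iff_ccw x, ccw_self]
    grind

/-- A point over a vertex of a polygon of `𝓑` that is not yet covered lies on a new polygon. -/
lemma Covers.exists_polygon {d : ℕ} (hd : 0 < d) {𝓐 𝓑 : Set Polygon} (h : Covers d 𝓐 𝓑)
    (h𝓑 : ∀ P ∈ 𝓑, ∀ Q ∈ 𝓑, P ≠ Q → P.IsDisjoint Q) {Q : Polygon} (hQ : Q ∈ 𝓑) {u : S}
    (huQ : sigma d u ∈ Q.vertices) (hu : ∀ A ∈ 𝓐, u ∉ A.vertices) :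
    ∃ P : Polygon, u ∈ P.vertices ∧ (∀ A ∈ 𝓐, P.IsDisjoint A) ∧ P.MapsAsPositiveCovering d ∧
      Q.vertices = sigma d '' P.vertices := by
  let V : Set S := {w | sigma d w ∈ Q.vertices ∧ Sees 𝓐 u w}
  have huV : u ∈ V := ⟨huQ, fun A hA => ⟨hu A hA, fun _ _ _ _ => not_crosses_self⟩⟩
  have hVfin : V.Finite := by
    refine (Q.finite.biUnion fun x _ => finite_sigma_fiber hd x).subset fun w hw => ?_
    exact mem_biUnion hw.1 rfl
  have hVnot : ∀ v ∈ V, ∀ A ∈ 𝓐, v ∉ A.vertices := fun v hv A hA => (hv.2 A hA).1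
  have walk : ∀ v ∈ V, ∀ y, IsSide Q.vertices (sigma d v) y → ∀ T : ℝ, 0 < T → T ≤ 1 →
      (∀ h : ℝ, 0 < h → h < T → v + (h : S) ∉ V) →
      (∀ A ∈ 𝓐, ∀ a ∈ A.vertices, ∀ b ∈ A.vertices, ccw v a < T → ccw v b < T) →
      sigma d (v + (T : S)) ≠ sigma d v ∧
        ccw (sigma d v) (sigma d (v + (T : S))) ≤ ccw (sigma d v) y := by
    intro v hv y hy T hT0 hT1 hfree hvis
    refine sigma_mem_Ioc_of_walk hd h.finite h.disjoint (hVnot v hv) hy.2.2.1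
      (fun A hA a b hab h1 h2 => h.ccw_lt_of_isSide h𝓑 hQ hA hy hab h1 h2) hT0 hT1
      (fun t h0 hT hsees hty => hfree t h0 hT ⟨hty ▸ hy.2.1, ?_⟩) hvis
    have hvu : Sees 𝓐 v u := hv.2.trans huV.2 hu
    exact hvu.trans hsees (hVnot v hv)
  -- If `u` were alone, a full turn would be an admissible walk, but it ends over `σ_d(u)`, which
  -- `walk` excludes.
  have hVn : V.Nontrivial := by
    by_contra hnot
    rw [not_nontrivial_iff] at hnot
    obtain ⟨y, hy⟩ := exists_isSide Q.finite Q.nontrivial huQ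
    have := walk u huV y hy 1 one_pos le_rfl (fun t h0 h1 hmem => ?_)
      (fun A _ a _ b _ _ => ccw_lt_one _ _)
    · have h1 : ((1 : ℝ) : S) = 0 := AddCircle.coe_period 1
      rw [h1, add_zero] at this
      exact this.1 rfl
    · have h2 := ccw_add_coe_of_mem u h0.le h1
      rw [hnot hmem huV, ccw_self] at h2
      linarith
  have hside : ∀ a b, IsSide V a b → IsSide Q.vertices (sigma d a) (sigma d b) := by
    intro a b hab
    obtain ⟨y, hy⟩ := exists_isSide Q.finite Q.nontrivial hab.1.1
    have key := walk a hab.1 y hy (ccw a b) (ccw_pos hab.2.2.1) (ccw_lt_one _ _).le ?_ ?_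
    · rw [add_ccw] at key
      -- The walk puts `σ_d(b)` in the arc `(σ_d(a), y]`, whose only vertex of `Q` is `y`.
      have : sigma d b = y := by
        by_contra hne
        exact hy.2.2.2 _ hab.2.1.1 (sbtw_iff_ccw_left.2
          ⟨ccw_pos key.1.symm, key.2.lt_of_ne fun h => hne (ccw_inj h)⟩)
      exact this ▸ hy
    · intro t h0 h1 hmem
      refine hab.2.2.2 _ hmem (sbtw_iff_ccw_left.2 ?_)
      rw [ccw_add_coe_of_mem a h0.le (h1.trans (ccw_lt_one _ _))]
      exact ⟨h0, h1⟩
    · intro A hA p hp q hq hlt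
      by_contra! hle
      have hsee : Sees 𝓐 a b := hab.1.2.trans hab.2.1.2 hu
      refine (hsee A hA).2 p hp q hq ?_
      have hqb : ccw a b ≠ ccw a q := fun h => (hsee A hA).1 (ccw_inj h ▸ hq)
      have hp0 : 0 < ccw a p := ccw_pos fun h => hVnot a hab.1 A hA (h ▸ hp)
      simp only [Crosses, sbtw_iff_ccw a, ccw_self]
      grind
  have himage : Q.vertices = sigma d '' V := by
    refine Subset.antisymm ?_ (image_subset_iff.2 fun w hw => hw.1)
    refine subset_of_isSide_closed Q.finite Q.nontrivial (image_subset_iff.2 fun w hw => hw.1)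
      ⟨_, mem_image_of_mem _ huV⟩ ?_
    rintro _ y ⟨v, hv, rfl⟩ hy
    obtain ⟨w, hw⟩ := exists_isSide hVfin hVn hv
    exact ⟨w, hw.2.1, (hside v w hw).right_unique hy⟩
  refine ⟨⟨V, hVfin, hVn⟩, huV, fun A hA => ⟨?_, ?_⟩, fun a b hab => ?_, himage⟩
  · exact disjoint_left.2 fun v hv => hVnot v hv A hA
  · intro a ha b hb c hc e he hx
    exact ((ha.2.trans hb.2 hu) A hA).2 c hc e he hx.symm
  · simpa only [← himage] using hside a b hab

/-- Polygons are added one at a time; each lowers the finite number of uncovered points over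
vertices of `𝓑`. -/
lemma Covers.exists_complete {d : ℕ} (hd : 0 < d) {𝓐 𝓑 : Set Polygon} (h : Covers d 𝓐 𝓑)
    (hfin : 𝓑.Finite) (h𝓑 : ∀ P ∈ 𝓑, ∀ Q ∈ 𝓑, P ≠ Q → P.IsDisjoint Q) :
    ∃ 𝓐', 𝓐 ⊆ 𝓐' ∧ Covers d 𝓐' 𝓑 ∧
      ∀ Q ∈ 𝓑, ∀ u, sigma d u ∈ Q.vertices → ∃ A ∈ 𝓐', u ∈ A.vertices := by
  have hfib : {u | ∃ Q ∈ 𝓑, sigma d u ∈ Q.vertices}.Finite := by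
    refine (hfin.biUnion fun Q _ => Q.finite.biUnion fun x _ => finite_sigma_fiber hd x).subset ?_
    rintro u ⟨Q, hQ, hu⟩
    exact mem_biUnion hQ (mem_biUnion hu rfl)
  induction hn : {u | (∃ Q ∈ 𝓑, sigma d u ∈ Q.vertices) ∧ ∀ A ∈ 𝓐, u ∉ A.vertices}.ncard
    using Nat.strong_induction_on generalizing 𝓐 with
  | _ n ih =>
  by_cases hall : ∀ Q ∈ 𝓑, ∀ u, sigma d u ∈ Q.vertices → ∃ A ∈ 𝓐, u ∈ A.vertices
  · exact ⟨𝓐, Subset.rfl, h, hall⟩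
  push Not at hall
  obtain ⟨Q, hQ, u, huQ, hu⟩ := hall
  obtain ⟨P, huP, hPd, hPc, hPQ⟩ := h.exists_polygon hd h𝓑 hQ huQ hu
  have hcov : Covers d (insert P 𝓐) 𝓑 := by
    refine ⟨h.finite.insert P, ?_, ?_, ?_⟩
    · rintro A (rfl | hA) B (rfl | hB) hne
      · exact absurd rfl hne
      · exact hPd B hB
      · exact (hPd A hA).symm
      · exact h.disjoint A hA B hB hne
    · rintro A (rfl | hA)
      · exact hPc
      · exact h.covering A hA
    · rintro A (rfl | hA)
      · exact ⟨Q, hQ, hPQ⟩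
      · exact h.image_mem A hA
  have hlt : {w | (∃ Q ∈ 𝓑, sigma d w ∈ Q.vertices) ∧
      ∀ A ∈ insert P 𝓐, w ∉ A.vertices}.ncard < n := by
    rw [← hn]
    refine ncard_lt_ncard ⟨fun w hw => ⟨hw.1, fun A hA => hw.2 A (mem_insert_of_mem _ hA)⟩,
      fun hsub => ?_⟩ (hfib.subset fun w hw => hw.1)
    exact (hsub ⟨⟨Q, hQ, huQ⟩, hu⟩).2 P (mem_insert _ _) huP
  obtain ⟨𝓐', hsub, hrest⟩ := ih _ hlt hcov rfl
  exact ⟨𝓐', (subset_insert _ _).trans hsub, hrest⟩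

/-- A set of disjoint polygons that maps to itself by positively oriented coverings and is
completely invariant on vertices. -/
structure CompletelyInvariant (d : ℕ) (G : Set Polygon) : Prop where
  disjoint : ∀ P ∈ G, ∀ Q ∈ G, P ≠ Q → P.IsDisjoint Q
  covering : ∀ P ∈ G, P.MapsAsPositiveCovering d
  image_mem : ∀ P ∈ G, ∃ Q ∈ G, Q.vertices = sigma d '' P.vertices
  exists_mem : ∀ Q ∈ G, ∀ u, sigma d u ∈ Q.vertices → ∃ P ∈ G, u ∈ P.vertices

lemma Covers.exists_completelyInvariant {d : ℕ} (hd : 0 < d) {F : Set Polygon}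
    (hF : Covers d F F) : ∃ G, F ⊆ G ∧ CompletelyInvariant d G := by
  have hnext : ∀ X : {𝓐 : Set Polygon // Covers d 𝓐 𝓐}, ∃ Y : {𝓐 : Set Polygon // Covers d 𝓐 𝓐},
      X.1 ⊆ Y.1 ∧ ∀ Q ∈ X.1, ∀ u, sigma d u ∈ Q.vertices → ∃ A ∈ Y.1, u ∈ A.vertices := by
    rintro ⟨𝓐, h⟩
    obtain ⟨𝓐', hsub, hcov, hex⟩ := h.exists_complete hd h.finite h.disjoint
    refine ⟨⟨𝓐', hcov.finite, hcov.disjoint, hcov.covering, fun A hA => ?_⟩, hsub, hex⟩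
    obtain ⟨B, hB, hBA⟩ := hcov.image_mem A hA
    exact ⟨B, hsub hB, hBA⟩
  choose next hsub hex using hnext
  let X : ℕ → {𝓐 : Set Polygon // Covers d 𝓐 𝓐} := fun n => next^[n] ⟨F, hF⟩
  have hX : ∀ n, X (n + 1) = next (X n) := fun n => Function.iterate_succ_apply' next n _
  have hmono : Monotone fun n => (X n).1 := monotone_nat_of_le_succ fun n => by
    simpa only [hX] using hsub (X n)
  refine ⟨⋃ n, (X n).1, subset_iUnion (fun n => (X n).1) 0, ?_, ?_, ?_, ?_⟩ <;>
    simp only [mem_iUnion]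
  · rintro P ⟨n, hP⟩ Q ⟨m, hQ⟩
    exact (X (max n m)).2.disjoint P (hmono (le_max_left n m) hP) Q (hmono (le_max_right n m) hQ)
  · rintro P ⟨n, hP⟩
    exact (X n).2.covering P hP
  · rintro P ⟨n, hP⟩
    obtain ⟨Q, hQ, h⟩ := (X n).2.image_mem P hP
    exact ⟨Q, ⟨n, hQ⟩, h⟩
  · rintro Q ⟨n, hQ⟩ u hu
    obtain ⟨P, hP, h⟩ := hex (X n) Q hQ u hu
    exact ⟨P, ⟨n + 1, by rwa [hX]⟩, h⟩

/-! ### The lamination generated by a completely invariant set of polygons -/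

/-- The directed sides of the polygons of `G`. -/
def directedSides (G : Set Polygon) : Set (S × S) := {p | ∃ P ∈ G, IsSide P.vertices p.1 p.2}

namespace CompletelyInvariant

variable {d : ℕ} {G : Set Polygon}

lemma eq_of_mem (hG : CompletelyInvariant d G) {P Q : Polygon} (hP : P ∈ G) (hQ : Q ∈ G) {a : S}
    (haP : a ∈ P.vertices) (haQ : a ∈ Q.vertices) : P = Q := by
  by_contra hne
  exact disjoint_left.1 (hG.disjoint P hP Q hQ hne).1 haP haQ

lemma not_crosses_of_isSide (hG : CompletelyInvariant d G) {P Q : Polygon} (hP : P ∈ G)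
    (hQ : Q ∈ G) {a b c e : S} (hab : IsSide P.vertices a b) (hc : c ∈ Q.vertices)
    (he : e ∈ Q.vertices) : ¬ Crosses a b c e := by
  by_cases h : P = Q
  · subst h
    rintro (h | h)
    · exact hab.2.2.2 c hc h.1
    · exact hab.2.2.2 e he h.1
  · exact (hG.disjoint P hP Q hQ h).2 a hab.1 b hab.2.1 c hc e he

lemma not_crosses_of_mem_closure (hG : CompletelyInvariant d G) {p q : S × S}
    (hp : p ∈ closure (directedSides G)) (hq : q ∈ closure (directedSides G)) :
    ¬ Crosses p.1 p.2 q.1 q.2 := by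
  intro h
  have hmem : (p, q) ∈ closure (directedSides G ×ˢ directedSides G) := by
    rw [closure_prod_eq]
    exact ⟨hp, hq⟩
  obtain ⟨⟨p', q'⟩, hx, ⟨P, hP, hp'⟩, ⟨Q, hQ, hq'⟩⟩ := mem_closure_iff.1 hmem _ isOpen_crosses h
  exact hG.not_crosses_of_isSide hP hQ hp' hq'.1 hq'.2.1 hx

/-- The closure of the set of all sides of polygons of `G`, together with all points. -/
def lamination (hG : CompletelyInvariant d G) : Lamination where
  chords := {l | l.IsDiag ∨ ∃ p ∈ closure (directedSides G), s(p.1, p.2) = l}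
  closed := by
    have h : {p : S × S | s(p.1, p.2) ∈ {l : Sym2 S | l.IsDiag ∨
        ∃ p ∈ closure (directedSides G), s(p.1, p.2) = l}} = {p | p.1 = p.2} ∪
        (closure (directedSides G) ∪ Prod.swap ⁻¹' closure (directedSides G)) := by
      ext ⟨a, b⟩
      simp only [mem_ofPred_eq, Sym2.mk_isDiag_iff, mem_union, mem_preimage, Prod.swap,
        Prod.exists, Sym2.eq_iff]
      refine or_congr Iff.rfl ⟨?_, ?_⟩
      · rintro ⟨a', b', h, ⟨rfl, rfl⟩ | ⟨rfl, rfl⟩⟩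
        · exact Or.inl h
        · exact Or.inr h
      · rintro (h | h)
        · exact ⟨a, b, h, Or.inl ⟨rfl, rfl⟩⟩
        · exact ⟨b, a, h, Or.inr ⟨rfl, rfl⟩⟩
    rw [h]
    exact (isClosed_eq continuous_fst continuous_snd).union
      (isClosed_closure.union (isClosed_closure.preimage continuous_swap))
  point_mem x := Or.inl rfl
  not_crosses a b c e hab hce h := by
    have hab' : a ≠ b := by
      rintro rfl
      rcases h with h | h <;> exact sbtw_irrefl_left_right h.1
    have hce' : c ≠ e := by
      rintro rfl
      exact not_crosses_self h
    obtain ⟨p, hp, hpe⟩ := hab.resolve_left (by simpa using hab')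
    obtain ⟨q, hq, hqe⟩ := hce.resolve_left (by simpa using hce')
    refine hG.not_crosses_of_mem_closure hp hq ?_
    rcases Sym2.eq_iff.1 hpe with ⟨h1, h2⟩ | ⟨h1, h2⟩ <;>
      rcases Sym2.eq_iff.1 hqe with ⟨h3, h4⟩ | ⟨h3, h4⟩ <;> rw [h1, h2, h3, h4]
    exacts [h, h.swap_right, h.swap_left, h.swap_left.swap_right]

lemma image_mem_directedSides (hG : CompletelyInvariant d G) {p : S × S}
    (hp : p ∈ directedSides G) : Prod.map (sigma d) (sigma d) p ∈ directedSides G := by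
  obtain ⟨P, hP, h⟩ := hp
  obtain ⟨Q, hQ, hQP⟩ := hG.image_mem P hP
  exact ⟨Q, hQ, hQP ▸ hG.covering P hP _ _ h⟩

lemma image_mem_closure (hG : CompletelyInvariant d G) {p : S × S}
    (hp : p ∈ closure (directedSides G)) :
    Prod.map (sigma d) (sigma d) p ∈ closure (directedSides G) :=
  map_mem_closure ((continuous_sigma d).prodMap (continuous_sigma d)) hp
    fun _ => hG.image_mem_directedSides

/-- The polygon at `w` has an image in `G` that shares the vertex `a` with `P`, hence is `P`, and
coverings respect successors. -/
lemma exists_isSide_over (hG : CompletelyInvariant d G) {P : Polygon} (hP : P ∈ G) {a b w : S}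
    (hab : IsSide P.vertices a b) (hw : sigma d w = a) :
    ∃ R ∈ G, ∃ c, IsSide R.vertices w c ∧ sigma d c = b := by
  obtain ⟨R, hR, hwR⟩ := hG.exists_mem P hP w (hw ▸ hab.1)
  obtain ⟨c, hc⟩ := exists_isSide R.finite R.nontrivial hwR
  obtain ⟨Q, hQ, hQR⟩ := hG.image_mem R hR
  have h := hG.covering R hR _ _ hc
  rw [← hQR, hw] at h
  obtain rfl := hG.eq_of_mem hQ hP h.1 hab.1
  exact ⟨R, hR, c, hc, h.right_unique hab⟩

lemma exists_preimage_mem_closure (hd : 0 < d) (hG : CompletelyInvariant d G) {p : S × S}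
    (hp : p ∈ closure (directedSides G)) :
    ∃ q ∈ closure (directedSides G), Prod.map (sigma d) (sigma d) q = p := by
  have hcl : IsClosed (Prod.map (sigma d) (sigma d) '' closure (directedSides G)) :=
    (isClosed_closure.isCompact.image
      ((continuous_sigma d).prodMap (continuous_sigma d))).isClosed
  refine closure_minimal ?_ hcl hp
  rintro ⟨a, b⟩ ⟨P, hP, hab⟩
  obtain ⟨w, hw⟩ := sigma_surjective hd a
  obtain ⟨R, hR, c, hc, hcb⟩ := hG.exists_isSide_over hP hab hw
  exact ⟨(w, c), subset_closure ⟨R, hR, hc⟩, by simp [hw, hcb]⟩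

/-- The leaves over the image of a leaf `p` that issue from the points over the image of `p.1`. -/
lemma exists_siblings_of_mem_closure (hd : 0 < d) (hG : CompletelyInvariant d G) {p : S × S}
    (hp : p ∈ closure (directedSides G)) :
    ∃ f : Fin d → S, (∃ k, rotate d p.1 k = p.1 ∧ f k = p.2) ∧
      (∀ k, (rotate d p.1 k, f k) ∈ closure (directedSides G)) ∧
      (∀ k, sigma d (f k) = sigma d p.2) ∧ Function.Injective f := by
  let k₀ : Fin d := ⟨0, hd⟩
  have hrot : ∀ a, rotate d a k₀ = a := fun a => by simp [rotate, k₀]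
  have hrotc : ∀ k, Continuous fun a => rotate d a k := fun k => continuous_id.add continuous_const
  -- Distinct points of a fibre differ by an element of the finite set `D`. This turns distinctness
  -- of siblings into a closed condition, so that it survives limits.
  let D : Set S := {w | sigma d w = 0} \ {0}
  have hD : IsClosed D := ((finite_sigma_fiber hd 0).subset sdiff_subset).isClosed
  let K : Set ((S × S) × (Fin d → S)) := {q | q.2 k₀ = q.1.2 ∧
    (∀ k, (rotate d q.1.1 k, q.2 k) ∈ closure (directedSides G)) ∧
    (∀ k, sigma d (q.2 k) = sigma d q.1.2) ∧ ∀ k l, k ≠ l → q.2 k - q.2 l ∈ D}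
  have hK : IsClosed K := by
    have hall : ∀ {ι : Type} {p : ι → (S × S) × (Fin d → S) → Prop},
        (∀ i, IsClosed {q | p i q}) → IsClosed {q | ∀ i, p i q} := fun h => by
      rw [ofPred_forall]
      exact isClosed_iInter h
    refine (isClosed_eq (by fun_prop) (by fun_prop)).inter
      (.inter (hall fun k => ?_) (.inter (hall fun k => ?_) (hall fun k => hall fun l => ?_)))
    · exact isClosed_closure.preimage
        (((hrotc k).comp (continuous_fst.comp continuous_fst)).prodMk (by fun_prop))
    · exact isClosed_eq ((continuous_sigma d).comp (by fun_prop))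
        ((continuous_sigma d).comp (by fun_prop))
    · by_cases hkl : k = l
      · simp [hkl]
      · simp only [ne_eq, hkl, not_false_eq_true, forall_const]
        exact hD.preimage (by fun_prop)
  -- The projection of the compact set `K` is closed, so it suffices to treat genuine sides. There
  -- `f k` is the successor of the `k`-th rotated point on its polygon.
  have hKp : p ∈ Prod.fst '' K := by
    refine closure_minimal ?_ (hK.isCompact.image continuous_fst).isClosed hp
    rintro ⟨a, b⟩ ⟨P, hP, hab⟩
    obtain ⟨Q, hQ, hQP⟩ := hG.image_mem P hP
    have hσ := hG.covering P hP _ _ hab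
    rw [← hQP] at hσ
    choose R hR f hf hfb using fun k => hG.exists_isSide_over hQ hσ (sigma_rotate d a k)
    refine ⟨((a, b), f), ⟨?_, fun k => subset_closure ⟨R k, hR k, hf k⟩, hfb, ?_⟩, rfl⟩
    · have h := hf k₀
      rw [hrot] at h
      rw [hG.eq_of_mem (hR k₀) hP h.1 hab.1] at h
      exact h.right_unique hab
    · intro k l hkl
      refine ⟨?_, fun h0 => hkl (rotate_injective d a ?_)⟩
      · have h := (hfb k).trans (hfb l).symm
        simp only [sigma, mem_ofPred_eq, smul_sub] at h ⊢
        rw [h, sub_self]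
      · have h : f k = f l := sub_eq_zero.1 h0
        have hl := hf l
        rw [← h, ← hG.eq_of_mem (hR k) (hR l) (hf k).2.1 (h ▸ (hf l).2.1)] at hl
        exact (hf k).left_unique hl
  obtain ⟨⟨q, f⟩, ⟨h1, h2, h3, h4⟩, rfl⟩ := hKp
  refine ⟨f, ⟨k₀, hrot _, h1⟩, h2, h3, fun k l hkl => ?_⟩
  by_contra hne
  exact (h4 k l hne).2 (sub_eq_zero.2 hkl)

lemma lamination_isInvariant (hd : 0 < d) (hG : CompletelyInvariant d G) :
    hG.lamination.IsInvariant d where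
  image_mem := by
    rintro l (hl | ⟨p, hp, rfl⟩)
    · exact Or.inr (hl.map)
    · exact Or.inl (Or.inr ⟨_, hG.image_mem_closure hp, rfl⟩)
  exists_preimage := by
    rintro l (hl | ⟨p, hp, rfl⟩)
    · induction l using Sym2.ind with
      | _ a b =>
        obtain rfl : a = b := by simpa using hl
        obtain ⟨w, rfl⟩ := sigma_surjective hd a
        exact ⟨s(w, w), Or.inl rfl, rfl⟩
    · obtain ⟨q, hq, rfl⟩ := hG.exists_preimage_mem_closure hd hp
      exact ⟨_, Or.inr ⟨q, hq, rfl⟩, rfl⟩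
  exists_siblings := by
    rintro l (hl | ⟨p, hp, rfl⟩) hne
    · exact absurd hl.map hne
    have hne' : sigma d p.1 ≠ sigma d p.2 := by simpa [sigmaChord] using hne
    obtain ⟨f, ⟨k₀, hk₀, hfk₀⟩, hf, hfσ, hinj⟩ := hG.exists_siblings_of_mem_closure hd hp
    refine ⟨fun k => s(rotate d p.1 k, f k), ⟨k₀, by simp only [hk₀, hfk₀]⟩,
      fun k => ⟨Or.inr ⟨_, hf k, rfl⟩, ?_⟩, ?_⟩
    · simp [sigmaChord, sigma_rotate, hfσ]
    · rintro i j hij x ⟨hi, hj⟩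
      rcases Sym2.mem_iff.1 hi with rfl | rfl <;> rcases Sym2.mem_iff.1 hj with h | h
      · exact hij (rotate_injective d _ h)
      · exact hne' (by rw [← sigma_rotate d p.1 i, h, hfσ])
      · exact hne' (by rw [← sigma_rotate d p.1 j, ← h, hfσ])
      · exact hij (hinj h)

lemma lamination_hasPolygon (hG : CompletelyInvariant d G) {P : Polygon} (hP : P ∈ G) :
    hG.lamination.HasPolygon P := by
  have key : ∀ a ∈ P.vertices, ∀ b ∈ P.vertices, a ≠ b → (a, b) ∈ closure (directedSides G) →
      IsSide P.vertices a b ∨ IsSide P.vertices b a := by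
    intro a ha b hb hab hmem
    by_contra! hnot
    obtain ⟨c, hc, hacb⟩ : ∃ c ∈ P.vertices, sbtw a c b := by
      by_contra! h
      exact hnot.1 ⟨ha, hb, hab, h⟩
    obtain ⟨e, he, hbea⟩ : ∃ e ∈ P.vertices, sbtw b e a := by
      by_contra! h
      exact hnot.2 ⟨hb, ha, hab.symm, h⟩
    -- A limit of sides that is a diagonal crosses another diagonal `ce`; then a nearby genuine side
    -- crosses `ce` as well.
    have hopen : IsOpen {p : S × S | Crosses p.1 p.2 c e} :=
      isOpen_crosses.preimage (f := fun p : S × S => (p, (c, e))) (by fun_prop)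
    obtain ⟨q, hx, Q, hQ, hq⟩ := mem_closure_iff.1 hmem _ hopen (Or.inl ⟨hacb, hbea⟩)
    exact hG.not_crosses_of_isSide hQ hP hq hc he hx
  intro a ha b hb hab
  constructor
  · rintro (h | ⟨⟨a', b'⟩, hp, h⟩)
    · exact absurd (by simpa using h) hab
    · rcases Sym2.eq_iff.1 h with ⟨rfl, rfl⟩ | ⟨rfl, rfl⟩
      · exact key _ ha _ hb hab hp
      · exact (key _ hb _ ha hab.symm hp).symm
  · rintro (h | h)
    · exact Or.inr ⟨(a, b), subset_closure ⟨P, hP, h⟩, rfl⟩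
    · exact Or.inr ⟨(b, a), subset_closure ⟨P, hP, h⟩, Sym2.eq_swap⟩

end CompletelyInvariant

end Lam

theorem mainTheorem1 (d : ℕ) (hd : 2 ≤ d) (F : Set Lam.Polygon) (hfin : F.Finite)
    (hdisj : ∀ P ∈ F, ∀ Q ∈ F, P ≠ Q → P.IsDisjoint Q)
    (hinv : Lam.ForwardInvariant d F) :
    (∃ L : Lam.Lamination, L.IsInvariant d ∧ ∀ P ∈ F, L.HasPolygon P) ↔
      ∀ P ∈ F, P.MapsAsPositiveCovering d := by
  have hd0 : 0 < d := by omega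
  constructor
  · rintro ⟨L, hL, hF⟩ P hP
    obtain ⟨hside, Q, hQ, hPQ⟩ := hinv P hP
    exact hL.mapsAsPositiveCovering hd0 (hF P hP) (hF Q hQ) hPQ hside
  · intro hcov
    obtain ⟨G, hFG, hG⟩ := Lam.Covers.exists_completelyInvariant hd0
      ⟨hfin, hdisj, hcov, fun P hP => (hinv P hP).2⟩
    exact ⟨hG.lamination, hG.lamination_isInvariant hd0, fun P hP =>
      hG.lamination_hasPolygon (hFG hP)⟩
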